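/- Let $\mathbb K=\mathbb R$ or $\mathbb C$. All notions are local and analytic, in the sense of Lie. A \emph{local group} with $r$ parameters is an analytic composition law $\varphi(a,b)$, defined for $a,b\in\mathbb K^r$ near $0$, that is associative and has $0$ as identity. Two local groups are \emph{isomorphic} if an analytic and analytically invertible correspondence between neighbourhoods of their identities respects the composition laws. A \emph{continuous transformation group} (ctg) $\Gamma$ in $n$ variables with $r$ essential parameters consists of such a law $\varphi$ and of transformations $x'=f(x,a)$, analytic for $(x,a)\in\mathbb K^n\times\mathbb K^r$ near a point $(x_0,0)$, such that, near that point, $f(x,0)=x$ and $f(f(x,a),b)=f(x,\varphi(a,b))$, and such that for $a$ near $0$ the transformation $x\mapsto f(x,a)$ is the identity near $x_0$ only if $a=0$. It is \emph{transitive} if for every neighbourhood $V$ of $0\in\mathbb K^r$ the set $f(x_0,V)$ is a neighbourhood of $x_0$. A \emph{representation of $\Gamma$ in an $s$-dimensional space} is a transitive ctg in $s$ variables whose parameter group is isomorphic to the parameter group of $\Gamma$ (that is, a faithful transitive representation). A \emph{subgroup of order $m$} of $\Gamma$ is an $m$-parameter local group with an analytic homomorphism into the parameter group of $\Gamma$,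 defined near the identity, whose derivative at the identity is injective; its \emph{index} is $r-m$. Containment of subgroups and normality are understood for elements near the identity. \textbf{Theorem.} Let $\Gamma$ be a ctg and let $s\ge 0$ be an integer. Then $\Gamma$ has a representation in an $s$-dimensional space if and only if $\Gamma$ has a subgroup of index $s$ that contains no normal subgroup of $\Gamma$ other than the identity group (the subgroup of order $0$). -/

import Mathlib

open Filter Topology

/-- A (local) continuous group with `r` parameters over `𝕜` (that is, `ℝ` or `ℂ`): a composition law
`φ(a, b) = mul a b` for parameter systems `a, b ∈ 𝕜ʳ` near `0`, analytic near `(0, 0)`, associative,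
and with the parameter system `0` as identity. Everything is understood near `0`; values far
from `0` carry no meaning. Inverses near `0` exist by the implicit function theorem. -/
structure LocalLieGroup (𝕜 : Type*) [RCLike 𝕜] (r : ℕ) where
  /-- the composition law of the parameters -/
  mul : (Fin r → 𝕜) → (Fin r → 𝕜) → (Fin r → 𝕜)
  analyticAt_mul : AnalyticAt 𝕜
    (fun p : (Fin r → 𝕜) × (Fin r → 𝕜) => mul p.1 p.2) (0, 0)
  zero_mul : ∀ᶠ a in 𝓝 (0 : Fin r → 𝕜), mul 0 a = a
  mul_zero : ∀ᶠ a in 𝓝 (0 : Fin r → 𝕜), mul a 0 = a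
  mul_assoc : ∀ᶠ p in 𝓝 ((0, 0, 0) : (Fin r → 𝕜) × (Fin r → 𝕜) × (Fin r → 𝕜)),
    mul (mul p.1 p.2.1) p.2.2 = mul p.1 (mul p.2.1 p.2.2)

/-- Two local groups are (locally) isomorphic: there is an analytic, analytically invertible
correspondence between neighbourhoods of their identities that respects the composition laws. -/
def LocalLieGroup.LocallyIsomorphic {𝕜 : Type*} [RCLike 𝕜] {r r' : ℕ}
    (G : LocalLieGroup 𝕜 r) (G' : LocalLieGroup 𝕜 r') : Prop :=
  ∃ (θ : (Fin r → 𝕜) → (Fin r' → 𝕜)) (η : (Fin r' → 𝕜) → (Fin r → 𝕜)),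
    AnalyticAt 𝕜 θ 0 ∧ AnalyticAt 𝕜 η 0 ∧ θ 0 = 0 ∧ η 0 = 0 ∧
    (∀ᶠ a in 𝓝 (0 : Fin r → 𝕜), η (θ a) = a) ∧
    (∀ᶠ a' in 𝓝 (0 : Fin r' → 𝕜), θ (η a') = a') ∧
    ∀ᶠ p in 𝓝 ((0, 0) : (Fin r → 𝕜) × (Fin r → 𝕜)),
      θ (G.mul p.1 p.2) = G'.mul (θ p.1) (θ p.2)

/-- A continuous subgroup of order `m` of the local group `G`: an `m`-parameter local group together
with an analytic immersion of it into `G` near the identity that respects the composition laws. -/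
structure LocalLieSubgroup {𝕜 : Type*} [RCLike 𝕜] {r : ℕ} (G : LocalLieGroup 𝕜 r) (m : ℕ) where
  /-- the `m`-parameter group itself -/
  group : LocalLieGroup 𝕜 m
  /-- the inclusion into `G` -/
  incl : (Fin m → 𝕜) → (Fin r → 𝕜)
  analyticAt_incl : AnalyticAt 𝕜 incl 0
  incl_zero : incl 0 = 0
  injective_fderiv : Function.Injective (fderiv 𝕜 incl 0)
  incl_mul : ∀ᶠ p in 𝓝 ((0, 0) : (Fin m → 𝕜) × (Fin m → 𝕜)),
    incl (group.mul p.1 p.2) = G.mul (incl p.1) (incl p.2)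

/-- The subgroup `N` is normal in `G`: for `a` in `G` and `x` in `N` close to the identity, the
transform `a x a⁻¹` is again an element `y` of `N` close to the identity
(the equation is written as `a x = y a`). -/
def LocalLieSubgroup.IsNormal {𝕜 : Type*} [RCLike 𝕜] {r k : ℕ} {G : LocalLieGroup 𝕜 r}
    (N : LocalLieSubgroup G k) : Prop :=
  ∀ W ∈ 𝓝 (0 : Fin k → 𝕜), ∀ᶠ p in 𝓝 ((0, 0) : (Fin r → 𝕜) × (Fin k → 𝕜)),
    ∃ y ∈ W, G.mul p.1 (N.incl p.2) = G.mul (N.incl y) p.1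

/-- The subgroup `N` is contained in the subgroup `H`: all elements of `N` close to the identity
are elements of `H` close to the identity. -/
def LocalLieSubgroup.IsContainedIn {𝕜 : Type*} [RCLike 𝕜] {r k m : ℕ} {G : LocalLieGroup 𝕜 r}
    (N : LocalLieSubgroup G k) (H : LocalLieSubgroup G m) : Prop :=
  ∀ W ∈ 𝓝 (0 : Fin m → 𝕜), ∀ᶠ x in 𝓝 (0 : Fin k → 𝕜), ∃ y ∈ W, H.incl y = N.incl x

/-- A continuous transformation group `x' = f(x, a)` in `n` variables `x` (near a point `base`) with
`r` essential parameters `a` (near `0`): `f` is analytic, `a = 0` gives the identity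
transformation, transformations are composed by the parameter law `φ` of the group
(`f(f(x, a), b) = f(x, φ(a, b))`), and near `0` only `a = 0` gives the identity transformation. -/
structure ContTransGroup (𝕜 : Type*) [RCLike 𝕜] (n r : ℕ) where
  /-- the parameter group -/
  group : LocalLieGroup 𝕜 r
  /-- the point of the representation space near which the transformations are considered -/
  base : Fin n → 𝕜
  /-- the transformations -/
  act : (Fin n → 𝕜) → (Fin r → 𝕜) → (Fin n → 𝕜)
  analyticAt_act : AnalyticAt 𝕜
    (fun p : (Fin n → 𝕜) × (Fin r → 𝕜) => act p.1 p.2) (base, 0)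
  act_zero : ∀ᶠ x in 𝓝 base, act x 0 = x
  act_act : ∀ᶠ p in 𝓝 ((base, 0, 0) : (Fin n → 𝕜) × (Fin r → 𝕜) × (Fin r → 𝕜)),
    act (act p.1 p.2.1) p.2.2 = act p.1 (group.mul p.2.1 p.2.2)
  effective : ∀ᶠ a in 𝓝 (0 : Fin r → 𝕜), (∀ᶠ x in 𝓝 base, act x a = x) → a = 0

/-- A continuous transformation group is transitive (near its base point): the transformations with
parameters arbitrarily close to `0` carry the base point to every point of a neighbourhood of it. -/
def ContTransGroup.IsTransitive {𝕜 : Type*} [RCLike 𝕜] {n r : ℕ}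
    (Γ : ContTransGroup 𝕜 n r) : Prop :=
  ∀ V ∈ 𝓝 (0 : Fin r → 𝕜), Γ.act Γ.base '' V ∈ 𝓝 Γ.base

/-- `Γ` has a (faithful, transitive) representation in an `s`-dimensional space: some transitive
continuous transformation group in `s` variables is isomorphic to `Γ`. -/
def ContTransGroup.HasRepresentation {𝕜 : Type*} [RCLike 𝕜] {n r : ℕ}
    (Γ : ContTransGroup 𝕜 n r) (s : ℕ) : Prop :=
  ∃ (r' : ℕ) (Γ' : ContTransGroup 𝕜 s r'),
    Γ'.IsTransitive ∧ Γ.group.LocallyIsomorphic Γ'.group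

/-! Transformations compose from left to right, so the model of a transitive action is `G` acting by
right multiplication on the right cosets `Hc`, with `H` the stabilizer of the base point.

From a representation to a subgroup: a transitive action in `s` variables has a stabilizer `H` of
index `s`. If `N` is normal and lies in `H`, then for `x` in `N` and `a` near the identity `a x = y
a` with `y` in `N`, whence `(x₀ a) x = (x₀ y) a = x₀ a`. By transitivity `x` fixes every point near
`x₀`, and faithfulness gives `x = 0` (`eventually_isTrivialAt_of_isNormal`).

From a subgroup to a representation: the coset action of `H` is transitive (`exists_coset_action`).
Its kernel is a normal subgroup (`exists_kernel`, `isNormal_of_kernel`) and fixes the base coset,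
hence lies in `H`; so it has order `0` and the action is faithful.

The analytic difficulty is that stabilizer and kernel are zero sets of maps not known to be
submersions. The group law supplies constant rank: translation by `b` carries the kernel of the
derivative at `0` into the kernel of the derivative at `b`. Projecting linearly onto the range of
the derivative at `0` yields a submersion with the same kernel at `0`, and every function whose
derivatives kill the translated kernels is constant on its fibres (`exists_eq_on_fibres`,
`exists_projection_eq_on_fibres`). The zeros of the submersion are then the group sought, with
coordinates from `exists_subgroup_of_zeros`. -/

/-! ### Inverse functions, submersions and constant rank -/

section Calculus

variable {𝕜 : Type*} [RCLike 𝕜]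
  {E : Type*} [NormedAddCommGroup E] [NormedSpace 𝕜 E]
  {F : Type*} [NormedAddCommGroup F] [NormedSpace 𝕜 F]
  {Y : Type*} [NormedAddCommGroup Y] [NormedSpace 𝕜 Y]

/-- The analytic inverse function theorem. -/
theorem AnalyticAt.exists_local_inverse [CompleteSpace E] [CompleteSpace F] {f : E → F} {a : E}
    (hf : AnalyticAt 𝕜 f a) (e : E ≃L[𝕜] F) (he : HasFDerivAt f (e : E →L[𝕜] F) a) :
    ∃ g : F → E, AnalyticAt 𝕜 g (f a) ∧ g (f a) = a ∧
      (∀ᶠ x in 𝓝 a, g (f x) = x) ∧ ∀ᶠ y in 𝓝 (f a), f (g y) = y := by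
  have hn : (⊤ : WithTop ℕ∞) ≠ 0 := by simp
  have hc : ContDiffAt 𝕜 ⊤ f a := hf.contDiffAt
  have hs := hc.hasStrictFDerivAt' he hn
  refine ⟨hc.localInverse he hn, ?_, hc.localInverse_apply_image he hn,
    hs.eventually_left_inverse, hs.eventually_right_inverse⟩
  exact ContDiffAt.analyticAt (hc.to_localInverse he hn)

/-- A submersion can be completed to a system of coordinates by a linear map. -/
theorem exists_linear_coordinates [FiniteDimensional 𝕜 E] [FiniteDimensional 𝕜 Y]
    (L : E →L[𝕜] Y) (hL : Function.Surjective L) {m : ℕ}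
    (hm : Module.finrank 𝕜 (LinearMap.ker L.toLinearMap) = m) :
    ∃ (Q : E →L[𝕜] (Fin m → 𝕜)) (e : E ≃L[𝕜] Y × (Fin m → 𝕜)),
      (e : E →L[𝕜] Y × (Fin m → 𝕜)) = L.prod Q := by
  set K := LinearMap.ker L.toLinearMap with hK
  obtain ⟨q, hq⟩ := K.subtype.exists_leftInverse_of_injective K.ker_subtype
  have hq' : ∀ x : K, q x = x := fun x => LinearMap.congr_fun hq x
  let i : K ≃ₗ[𝕜] (Fin m → 𝕜) := LinearEquiv.ofFinrankEq _ _ (by simp [hm])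
  let T : E →ₗ[𝕜] Y × (Fin m → 𝕜) := L.toLinearMap.prod (i.toLinearMap ∘ₗ q)
  have hT : Function.Bijective T := by
    constructor
    · rw [injective_iff_map_eq_zero]
      intro x hx
      have h1 : L x = 0 := congrArg Prod.fst hx
      have h2 : i (q x) = 0 := congrArg Prod.snd hx
      have h3 : q x = 0 := by simpa using h2
      have := hq' ⟨x, h1⟩
      rw [h3] at this
      exact (congrArg Subtype.val this).symm
    · rintro ⟨y, w⟩
      obtain ⟨x, rfl⟩ := hL y
      refine ⟨x + ((i.symm w - q x : K) : E), Prod.ext ?_ ?_⟩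
      · have : L ((i.symm w - q x : K) : E) = 0 := (i.symm w - q x).2
        change L (x + _) = L x
        rw [map_add, this, add_zero]
      · change i (q (x + _)) = w
        rw [map_add, hq']
        simp
  let e := (LinearEquiv.ofBijective T hT).toContinuousLinearEquiv
  refine ⟨LinearMap.toContinuousLinearMap (i.toLinearMap ∘ₗ q), e, ?_⟩
  ext x <;> rfl

/-- Local coordinates adapted to a submersion. -/
theorem AnalyticAt.exists_adapted_coordinates [FiniteDimensional 𝕜 E] [FiniteDimensional 𝕜 Y]
    {P : E → Y} (hP : AnalyticAt 𝕜 P 0) (hP0 : P 0 = 0)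
    (hs : Function.Surjective (fderiv 𝕜 P 0)) {m : ℕ}
    (hm : Module.finrank 𝕜 (LinearMap.ker (fderiv 𝕜 P 0).toLinearMap) = m) :
    ∃ (Q : E →L[𝕜] (Fin m → 𝕜)) (e : E ≃L[𝕜] Y × (Fin m → 𝕜)) (Ψ : Y × (Fin m → 𝕜) → E),
      (e : E →L[𝕜] Y × (Fin m → 𝕜)) = (fderiv 𝕜 P 0).prod Q ∧
      AnalyticAt 𝕜 Ψ 0 ∧ Ψ 0 = 0 ∧ HasFDerivAt Ψ (e.symm : Y × (Fin m → 𝕜) →L[𝕜] E) 0 ∧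
      (∀ᶠ x in 𝓝 0, Ψ (P x, Q x) = x) ∧
      ∀ᶠ p in 𝓝 0, P (Ψ p) = p.1 ∧ Q (Ψ p) = p.2 := by
  have := FiniteDimensional.complete 𝕜 E
  have := FiniteDimensional.complete 𝕜 Y
  obtain ⟨Q, e, he⟩ := exists_linear_coordinates _ hs hm
  have hF : AnalyticAt 𝕜 (fun x => (P x, Q x)) 0 := hP.prod (Q.analyticAt 0)
  have hd : HasFDerivAt (fun x => (P x, Q x)) (e : E →L[𝕜] Y × (Fin m → 𝕜)) 0 := by
    rw [he]
    exact hP.differentiableAt.hasFDerivAt.prodMk Q.hasFDerivAt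
  obtain ⟨Ψ, h1, h2, h3, h4⟩ := hF.exists_local_inverse e hd
  have h0 : (P 0, Q 0) = 0 := by simp [hP0]
  simp only [h0] at h1 h2 h4
  refine ⟨Q, e, Ψ, he, h1, h2, ?_, h3, h4.mono fun p hp => ⟨congrArg Prod.fst hp, congrArg Prod.snd hp⟩⟩
  refine HasFDerivAt.of_local_left_inverse (f := fun x => (P x, Q x)) h1.continuousAt ?_ h4
  rw [h2]; exact hd

/-- Let `P` be a submersion at `0` and `A b` a continuous family of linear maps, `A 0 = 1`, that
carries the kernel of `P' 0` into the kernels of `P' b` and of `g' b`. Then `g` is constant on the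
fibres of `P` near `0`, on a neighbourhood that does not depend on `g`. -/
theorem AnalyticAt.exists_eq_on_fibres [FiniteDimensional 𝕜 E] [FiniteDimensional 𝕜 Y]
    {P : E → Y} (hP : AnalyticAt 𝕜 P 0) (hP0 : P 0 = 0)
    (hs : Function.Surjective (fderiv 𝕜 P 0))
    {A : E → E →L[𝕜] E} (hA : ContinuousAt A 0) (hA0 : A 0 = ContinuousLinearMap.id 𝕜 E)
    {V : Set E} (hV : V ∈ 𝓝 0)
    (hPA : ∀ b ∈ V, ∀ v, fderiv 𝕜 P 0 v = 0 → fderiv 𝕜 P b (A b v) = 0) :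
    ∃ U ∈ 𝓝 (0 : E), ∀ g : E → F,
      (∀ b ∈ V, DifferentiableAt 𝕜 g b ∧
        ∀ v, fderiv 𝕜 P 0 v = 0 → fderiv 𝕜 g b (A b v) = 0) →
      ∀ a ∈ U, ∀ b ∈ U, P a = P b → g a = g b := by
  have := FiniteDimensional.complete 𝕜 E
  have := FiniteDimensional.complete 𝕜 Y
  obtain ⟨m, hm⟩ : ∃ m, Module.finrank 𝕜 (LinearMap.ker (fderiv 𝕜 P 0).toLinearMap) = m := ⟨_, rfl⟩
  obtain ⟨Q, e, Ψ, he, hΨ, hΨ0, -, hl, hr⟩ := hP.exists_adapted_coordinates hP0 hs hm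
  set L := fderiv 𝕜 P 0 with hL
  have htΨ : Tendsto Ψ (𝓝 0) (𝓝 0) := by simpa [hΨ0] using hΨ.continuousAt.tendsto
  -- The inclusion of kernels is an equality near `0`: `(P' b ∘ A b, Q)` equals `e` at `b = 0` and
  -- invertibility is an open condition, so for small `b` a kernel vector of `P' b` is recovered
  -- from its `Q`-coordinate.
  have hker : ∀ᶠ b in 𝓝 (0 : E), ∀ u, fderiv 𝕜 P b u = 0 → ∃ v, L v = 0 ∧ u = A b v := by
    have hC : ContinuousAt (fun b => ((fderiv 𝕜 P b).comp (A b)).prod Q) 0 := by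
      have h1 : ContinuousAt (fun b => (fderiv 𝕜 P b).comp (A b)) 0 :=
        hP.fderiv.continuousAt.clm_comp hA
      exact (ContinuousLinearMap.prodₗᵢ (𝕜 := 𝕜) (E := E) (F := Y) (G := Fin m → 𝕜)
        𝕜).continuous.continuousAt.comp (h1.prodMk continuousAt_const)
    have hC' : ∀ᶠ b in 𝓝 (0 : E), ((fderiv 𝕜 P b).comp (A b)).prod Q ∈
        Set.range ((↑) : (E ≃L[𝕜] Y × (Fin m → 𝕜)) → E →L[𝕜] Y × (Fin m → 𝕜)) := by
      apply hC.eventually_mem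
      have : (((fderiv 𝕜 P 0).comp (A 0)).prod Q) = (e : E →L[𝕜] Y × (Fin m → 𝕜)) := by
        rw [he, hA0]; rfl
      rw [this]
      exact e.nhds
    have hA' : ∀ᶠ b in 𝓝 (0 : E), A b ∈ Set.range ((↑) : (E ≃L[𝕜] E) → E →L[𝕜] E) := by
      apply hA.eventually_mem
      rw [hA0]
      exact (ContinuousLinearEquiv.refl 𝕜 E).nhds
    filter_upwards [hC', hA', hV] with b ⟨c, hc⟩ ⟨α, hα⟩ hb u hu
    have hαv : ∀ v, A b v = α v := fun v => by rw [← hα]; rfl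
    have hcv : ∀ v, c v = (fderiv 𝕜 P b (A b v), Q v) := fun v => by
      change (c : E →L[𝕜] Y × (Fin m → 𝕜)) v = _
      rw [hc]; rfl
    have hev : ∀ v, e v = (L v, Q v) := fun v => by
      change (e : E →L[𝕜] Y × (Fin m → 𝕜)) v = _
      rw [he]; rfl
    refine ⟨e.symm (0, Q (α.symm u)), ?_, ?_⟩
    · exact congrArg Prod.fst ((hev _).symm.trans (e.apply_symm_apply _))
    · have hz : α.symm u = e.symm (0, Q (α.symm u)) := by
        apply c.injective
        have h1 := (hev _).symm.trans (e.apply_symm_apply (0, Q (α.symm u)))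
        rw [hcv, hcv, hαv, α.apply_symm_apply, hu, hPA b hb _ (congrArg Prod.fst h1)]
        exact congrArg (Prod.mk 0) (congrArg Prod.snd h1).symm
      rw [← hz, hαv, α.apply_symm_apply]
  have hgood : ∀ᶠ p in 𝓝 (0 : Y × (Fin m → 𝕜)), Ψ p ∈ V ∧ DifferentiableAt 𝕜 Ψ p ∧
      (∀ᶠ q in 𝓝 p, P (Ψ q) = q.1) ∧ DifferentiableAt 𝕜 P (Ψ p) ∧
      ∀ u, fderiv 𝕜 P (Ψ p) u = 0 → ∃ v, L v = 0 ∧ u = A (Ψ p) v := by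
    filter_upwards [htΨ hV, hΨ.eventually_analyticAt, (hr.mono fun p hp => hp.1).eventually_nhds,
      htΨ.eventually hP.eventually_analyticAt, htΨ.eventually hker] with p h1 h2 h3 h4 h5
    exact ⟨h1, h2.differentiableAt, h3, h4.differentiableAt, h5⟩
  obtain ⟨ε, hε, hball⟩ := Metric.eventually_nhds_iff_ball.1 hgood
  have hΦ : ∀ᶠ a in 𝓝 (0 : E), (P a, Q a) ∈ Metric.ball (0 : Y × (Fin m → 𝕜)) ε := by
    have : ContinuousAt (fun a => (P a, Q a)) 0 := hP.continuousAt.prodMk Q.continuous.continuousAt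
    apply this.eventually_mem
    have h0 : (P 0, Q 0) = 0 := by simp [hP0]
    rw [h0]
    exact Metric.ball_mem_nhds _ hε
  refine ⟨_, hΦ.and hl, fun g hg a ha b hb hab => ?_⟩
  have hmem : ∀ w ∈ Metric.ball (0 : Fin m → 𝕜) ε, (P a, w) ∈ Metric.ball (0 : Y × (Fin m → 𝕜)) ε := by
    intro w hw
    have h1 := ha.1
    simp only [mem_ball_zero_iff, Prod.norm_def, sup_lt_iff] at h1 hw ⊢
    exact ⟨h1.1, hw⟩
  have hsnd : ∀ c, (P c, Q c) ∈ Metric.ball (0 : Y × (Fin m → 𝕜)) ε →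
      Q c ∈ Metric.ball (0 : Fin m → 𝕜) ε := by
    intro c hc
    simp only [mem_ball_zero_iff, Prod.norm_def, sup_lt_iff] at hc ⊢
    exact hc.2
  -- Since `P (Ψ (P a, w))` does not depend on `w`, tangent vectors of the fibre lie in the kernel
  -- of `P'`; by `hker` they have the form `A b v`, which `g'` kills.
  have hder : ∀ w ∈ Metric.ball (0 : Fin m → 𝕜) ε,
      HasFDerivAt (𝕜 := 𝕜) (fun w => g (Ψ (P a, w))) 0 w := by
    intro w hw
    obtain ⟨h1, h2, h3, h4, h5⟩ := hball _ (hmem w hw)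
    have hι : HasFDerivAt (fun w : Fin m → 𝕜 => (P a, w))
        (ContinuousLinearMap.inr 𝕜 Y (Fin m → 𝕜)) w := hasFDerivAt_prodMk_right _ _
    have hψ := h2.hasFDerivAt.comp w hι
    have hP1 := h4.hasFDerivAt.comp w hψ
    have hP2 : HasFDerivAt (P ∘ Ψ ∘ fun w : Fin m → 𝕜 => (P a, w)) (0 : (Fin m → 𝕜) →L[𝕜] Y) w := by
      refine (hasFDerivAt_const (P a) w).congr_of_eventuallyEq ?_
      exact hι.continuousAt.eventually h3
    have hzero := hP1.unique hP2
    have hgc := (hg _ h1).1.hasFDerivAt.comp w hψ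
    convert! hgc using 1
    ext1 u
    obtain ⟨v, hv, huv⟩ := h5 ((fderiv 𝕜 Ψ (P a, w)).comp (ContinuousLinearMap.inr 𝕜 Y (Fin m → 𝕜)) u)
      (DFunLike.congr_fun hzero u)
    exact ((congrArg (fderiv 𝕜 g (Ψ (P a, w))) huv).trans ((hg _ h1).2 v hv)).symm
  have key := Convex.is_const_of_fderivWithin_eq_zero (𝕜 := 𝕜) (f := fun w => g (Ψ (P a, w)))
    (convex_ball (0 : Fin m → 𝕜) ε)
    (fun w hw => (hder w hw).differentiableAt.differentiableWithinAt)
    (fun w hw => by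
      rw [fderivWithin_of_isOpen Metric.isOpen_ball hw, (hder w hw).fderiv])
    (hsnd a ha.1) (hsnd b hb.1)
  rwa [ha.2, hab, hb.2] at key

/-- A map whose derivative has, by homogeneity, constant rank near `0` is constant on the fibres of
a submersion obtained from it by a linear projection. -/
theorem AnalyticAt.exists_projection_eq_on_fibres [FiniteDimensional 𝕜 E] [FiniteDimensional 𝕜 Y]
    {f : E → Y} (hf : AnalyticAt 𝕜 f 0) (hf0 : f 0 = 0)
    {A : E → E →L[𝕜] E} (hA : ContinuousAt A 0) (hA0 : A 0 = ContinuousLinearMap.id 𝕜 E)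
    {V : Set E} (hV : V ∈ 𝓝 0)
    (hfA : ∀ b ∈ V, DifferentiableAt 𝕜 f b ∧
      ∀ v, fderiv 𝕜 f 0 v = 0 → fderiv 𝕜 f b (A b v) = 0) :
    ∃ p : Y →L[𝕜] LinearMap.range (fderiv 𝕜 f 0).toLinearMap,
      (∀ y : LinearMap.range (fderiv 𝕜 f 0).toLinearMap, p y = y) ∧
      AnalyticAt 𝕜 (fun a => p (f a)) 0 ∧
      Function.Surjective (fderiv 𝕜 (fun a => p (f a)) 0) ∧
      (∀ v, fderiv 𝕜 (fun a => p (f a)) 0 v = 0 ↔ fderiv 𝕜 f 0 v = 0) ∧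
      ∃ U ∈ 𝓝 (0 : E), ∀ g : E → F,
        (∀ b ∈ V, DifferentiableAt 𝕜 g b ∧
          ∀ v, fderiv 𝕜 f 0 v = 0 → fderiv 𝕜 g b (A b v) = 0) →
        ∀ a ∈ U, ∀ b ∈ U, p (f a) = p (f b) → g a = g b := by
  set L := fderiv 𝕜 f 0 with hL
  set R := LinearMap.range L.toLinearMap with hR
  obtain ⟨q, hq⟩ := R.subtype.exists_leftInverse_of_injective R.ker_subtype
  have hq' : ∀ x : R, q x = x := fun x => LinearMap.congr_fun hq x
  let p : Y →L[𝕜] R := LinearMap.toContinuousLinearMap q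
  have hp : ∀ x : R, p x = x := hq'
  have hd : ∀ b, DifferentiableAt 𝕜 f b →
      fderiv 𝕜 (fun a => p (f a)) b = p.comp (fderiv 𝕜 f b) := fun b hb =>
    (p.hasFDerivAt.comp b hb.hasFDerivAt).fderiv
  have hd0 : ∀ v, fderiv 𝕜 (fun a => p (f a)) 0 v = ⟨L v, LinearMap.mem_range_self L.toLinearMap v⟩ :=
    fun v => by
      rw [hd 0 hf.differentiableAt]
      exact hp ⟨L v, LinearMap.mem_range_self L.toLinearMap v⟩
  have han : AnalyticAt 𝕜 (fun a => p (f a)) 0 := (p.analyticAt _).comp hf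
  have hsurj : Function.Surjective (fderiv 𝕜 (fun a => p (f a)) 0) := by
    rintro ⟨y, v, rfl⟩
    exact ⟨v, hd0 v⟩
  have hker : ∀ v, fderiv 𝕜 (fun a => p (f a)) 0 v = 0 ↔ L v = 0 := fun v => by
    rw [hd0, Submodule.mk_eq_zero]
  obtain ⟨U, hU, h⟩ := han.exists_eq_on_fibres (F := F) (by simp [hf0]) hsurj hA hA0 hV
    (fun b hb v hv => by
      rw [hd b (hfA b hb).1]
      have := (hfA b hb).2 v ((hker v).1 hv)
      exact (congrArg p this).trans (map_zero p))
  refine ⟨p, hp, han, hsurj, hker, U, hU, fun g hg => h g fun b hb => ⟨(hg b hb).1, fun v hv =>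
    (hg b hb).2 v ((hker v).1 hv)⟩⟩

/-- An analytic family of transformations `g a` with `g 0 = 1` can be inverted analytically. -/
theorem AnalyticAt.exists_family_inverse [FiniteDimensional 𝕜 E] [FiniteDimensional 𝕜 F]
    {g : E → F → F} {x₀ : F} (hg : AnalyticAt 𝕜 (fun p : E × F => g p.1 p.2) (0, x₀))
    (h0 : ∀ᶠ x in 𝓝 x₀, g 0 x = x) :
    ∃ h : E → F → F, AnalyticAt 𝕜 (fun p : E × F => h p.1 p.2) (0, x₀) ∧ h 0 x₀ = x₀ ∧
      (∀ᶠ p in 𝓝 ((0, x₀) : E × F), h p.1 (g p.1 p.2) = p.2) ∧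
      ∀ᶠ p in 𝓝 ((0, x₀) : E × F), g p.1 (h p.1 p.2) = p.2 := by
  have := FiniteDimensional.complete 𝕜 E
  have := FiniteDimensional.complete 𝕜 F
  set D := fderiv 𝕜 (fun p : E × F => g p.1 p.2) (0, x₀) with hD
  have hgD : HasFDerivAt (fun p : E × F => g p.1 p.2) D (0, x₀) := hg.differentiableAt.hasFDerivAt
  have hDx : ∀ v, D (0, v) = v := by
    have h1 := hgD.comp x₀ (hasFDerivAt_prodMk_right (𝕜 := 𝕜) (0 : E) x₀)
    have h2 : HasFDerivAt ((fun p : E × F => g p.1 p.2) ∘ fun x => ((0 : E), x))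
      (ContinuousLinearMap.id 𝕜 F) x₀ := (hasFDerivAt_id x₀).congr_of_eventuallyEq h0
    exact fun v => DFunLike.congr_fun (h1.unique h2) v
  have hDd : ∀ u v, D (u, v) = D (u, 0) + v := fun u v => by
    rw [← hDx v, ← map_add]; simp [hDx]
  -- The derivative of `(a, x) ↦ (a, g a x)` is block triangular with identity diagonal blocks,
  -- because `g 0` is the identity.
  let e : (E × F) ≃L[𝕜] (E × F) := ContinuousLinearEquiv.equivOfInverse
    ((ContinuousLinearMap.fst 𝕜 E F).prod D)
    ((ContinuousLinearMap.fst 𝕜 E F).prod (ContinuousLinearMap.snd 𝕜 E F -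
      D.comp ((ContinuousLinearMap.inl 𝕜 E F).comp (ContinuousLinearMap.fst 𝕜 E F))))
    (fun p => by
      obtain ⟨u, v⟩ := p
      simp [hDd u v])
    (fun p => by
      obtain ⟨u, v⟩ := p
      simp [hDd u (v - _)])
  have hΦ : AnalyticAt 𝕜 (fun p : E × F => (p.1, g p.1 p.2)) (0, x₀) := analyticAt_fst.prod hg
  obtain ⟨G, h1, h2, h3, h4⟩ := hΦ.exists_local_inverse e (hasFDerivAt_fst.prodMk hgD)
  have hx : g 0 x₀ = x₀ := h0.self_of_nhds
  simp only [hx] at h1 h2 h4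
  refine ⟨fun a x => (G (a, x)).2, analyticAt_snd.fun_comp h1, by simp [h2],
    h3.mono fun p hp => by simp [hp], h4.mono fun p hp => ?_⟩
  have h5 := congrArg Prod.fst hp
  have h6 := congrArg Prod.snd hp
  simp only at h5 h6 ⊢
  rwa [h5] at h6

/-- A finite number of points suffices to recognize the common kernel of linear maps. -/
theorem LinearMap.exists_finset_common_kernel {ι : Type*} [FiniteDimensional 𝕜 E]
    (D : ι → E →ₗ[𝕜] F) (B : Set ι) :
    ∃ t : Finset ι, ↑t ⊆ B ∧ ∀ v, (∀ x ∈ t, D x v = 0) → ∀ x ∈ B, D x v = 0 := by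
  classical
  -- Choose `t` with common kernel of least dimension; adjoining one more point of `B` can then no
  -- longer shrink it.
  obtain ⟨t, htB, hmin⟩ := WellFounded.has_min
    (InvImage.wf (fun t : Finset ι => Module.finrank 𝕜 (t.inf fun x => LinearMap.ker (D x) :
      Submodule 𝕜 E)) wellFounded_lt) {t : Finset ι | ↑t ⊆ B} ⟨∅, by simp⟩
  refine ⟨t, htB, fun v hv x hx => ?_⟩
  have hle : (insert x t).inf (fun x => LinearMap.ker (D x)) ≤ t.inf fun x => LinearMap.ker (D x) :=
    Finset.inf_mono (Finset.subset_insert x t)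
  have heq := Submodule.eq_of_le_of_finrank_le hle (not_lt.1 (hmin (insert x t)
    (by simpa [Set.insert_subset_iff] using ⟨hx, htB⟩)))
  have hv' : v ∈ t.inf fun x => LinearMap.ker (D x) := by
    rw [Submodule.mem_finsetInf]
    exact hv
  rw [← heq, Submodule.mem_finsetInf] at hv'
  exact hv' x (Finset.mem_insert_self x t)

/-- An injective linear map can be completed to a linear equivalence. -/
theorem ContinuousLinearMap.exists_complement [FiniteDimensional 𝕜 E] {m s : ℕ}
    (L : (Fin m → 𝕜) →L[𝕜] E) (hL : Function.Injective L) (hms : m + s = Module.finrank 𝕜 E) :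
    ∃ (σ : (Fin s → 𝕜) →L[𝕜] E) (e : ((Fin m → 𝕜) × (Fin s → 𝕜)) ≃L[𝕜] E),
      (e : (Fin m → 𝕜) × (Fin s → 𝕜) →L[𝕜] E) = L.coprod σ := by
  obtain ⟨C, hC⟩ := Submodule.exists_isCompl (LinearMap.range L.toLinearMap)
  have h1 := Submodule.finrank_add_eq_of_isCompl hC
  have h2 : Module.finrank 𝕜 (LinearMap.range L.toLinearMap) = m := by
    rw [LinearMap.finrank_range_of_inj hL, Module.finrank_fin_fun]
  have hCs : Module.finrank 𝕜 C = s := by omega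
  let j : (Fin s → 𝕜) ≃ₗ[𝕜] C := LinearEquiv.ofFinrankEq _ _ (by simp [hCs])
  let T : ((Fin m → 𝕜) × (Fin s → 𝕜)) →ₗ[𝕜] E := L.toLinearMap.coprod (C.subtype ∘ₗ j.toLinearMap)
  have hT : Function.Injective T := by
    rw [injective_iff_map_eq_zero]
    rintro ⟨h, x⟩ hx
    have hx' : L h + (j x : E) = 0 := hx
    have hr : L h ∈ LinearMap.range L.toLinearMap := ⟨h, rfl⟩
    have hc : L h ∈ C := by
      rw [eq_neg_of_add_eq_zero_left hx']
      exact C.neg_mem (j x).2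
    have h0 := Submodule.disjoint_def.1 hC.disjoint _ hr hc
    rw [h0, zero_add] at hx'
    have hj : j x = 0 := Subtype.ext hx'
    exact Prod.ext (hL (h0.trans (map_zero L).symm)) (by simpa using hj)
  let e := (T.linearEquivOfInjective hT (by simp [hms])).toContinuousLinearEquiv
  refine ⟨LinearMap.toContinuousLinearMap (C.subtype ∘ₗ j.toLinearMap), e, ?_⟩
  ext x <;> rfl

end Calculus

/-! ### Local groups: translations, division, subgroups as zero sets -/

namespace LocalLieGroup

variable {𝕜 : Type*} [RCLike 𝕜] {r : ℕ} (G : LocalLieGroup 𝕜 r)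

theorem mul_zero_zero : G.mul 0 0 = 0 := G.zero_mul.self_of_nhds

variable {G} in
theorem tendsto_mul {α : Type*} {l : Filter α} {f g : α → Fin r → 𝕜} (hf : Tendsto f l (𝓝 0))
    (hg : Tendsto g l (𝓝 0)) : Tendsto (fun x => G.mul (f x) (g x)) l (𝓝 0) := by
  have h := G.analyticAt_mul.continuousAt.tendsto.comp (hf.prodMk_nhds hg)
  simpa only [G.mul_zero_zero] using! h

theorem eventually_mul_assoc {α : Type*} {l : Filter α} {f g h : α → Fin r → 𝕜}
    (hf : Tendsto f l (𝓝 0)) (hg : Tendsto g l (𝓝 0)) (hh : Tendsto h l (𝓝 0)) :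
    ∀ᶠ x in l, G.mul (G.mul (f x) (g x)) (h x) = G.mul (f x) (G.mul (g x) (h x)) :=
  (hf.prodMk_nhds (hg.prodMk_nhds hh)).eventually G.mul_assoc

variable {G} in
theorem analyticAt_mul_comp {E : Type*} [NormedAddCommGroup E] [NormedSpace 𝕜 E]
    {f g : E → Fin r → 𝕜} {x : E} (hf : AnalyticAt 𝕜 f x) (hg : AnalyticAt 𝕜 g x)
    (hf0 : f x = 0) (hg0 : g x = 0) : AnalyticAt 𝕜 (fun x => G.mul (f x) (g x)) x := by
  have h : AnalyticAt 𝕜 (fun p : (Fin r → 𝕜) × (Fin r → 𝕜) => G.mul p.1 p.2) (f x, g x) := by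
    rw [hf0, hg0]; exact G.analyticAt_mul
  exact AnalyticAt.fun_comp (f := fun x => (f x, g x)) h (hf.prod hg)

/-- The derivative at `0` of the left translation by `b`. -/
noncomputable def leftDeriv (b : Fin r → 𝕜) : (Fin r → 𝕜) →L[𝕜] (Fin r → 𝕜) :=
  (fderiv 𝕜 (fun p : (Fin r → 𝕜) × (Fin r → 𝕜) => G.mul p.1 p.2) (b, 0)).comp
    (ContinuousLinearMap.inr 𝕜 _ _)

/-- The derivative at `0` of the right translation by `b`. -/
noncomputable def rightDeriv (b : Fin r → 𝕜) : (Fin r → 𝕜) →L[𝕜] (Fin r → 𝕜) :=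
  (fderiv 𝕜 (fun p : (Fin r → 𝕜) × (Fin r → 𝕜) => G.mul p.1 p.2) (0, b)).comp
    (ContinuousLinearMap.inl 𝕜 _ _)

theorem eventually_hasFDerivAt_leftDeriv :
    ∀ᶠ b in 𝓝 (0 : Fin r → 𝕜), HasFDerivAt (fun c => G.mul b c) (G.leftDeriv b) 0 := by
  have h : Tendsto (fun b : Fin r → 𝕜 => (b, (0 : Fin r → 𝕜))) (𝓝 0) (𝓝 (0, 0)) :=
    tendsto_id.prodMk_nhds tendsto_const_nhds
  filter_upwards [h.eventually G.analyticAt_mul.eventually_analyticAt] with b hb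
  exact hb.differentiableAt.hasFDerivAt.comp (0 : Fin r → 𝕜)
    (hasFDerivAt_prodMk_right (𝕜 := 𝕜) b (0 : Fin r → 𝕜))

theorem eventually_hasFDerivAt_rightDeriv :
    ∀ᶠ b in 𝓝 (0 : Fin r → 𝕜), HasFDerivAt (fun c => G.mul c b) (G.rightDeriv b) 0 := by
  have h : Tendsto (fun b : Fin r → 𝕜 => ((0 : Fin r → 𝕜), b)) (𝓝 0) (𝓝 (0, 0)) :=
    tendsto_const_nhds.prodMk_nhds tendsto_id
  filter_upwards [h.eventually G.analyticAt_mul.eventually_analyticAt] with b hb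
  exact hb.differentiableAt.hasFDerivAt.comp (0 : Fin r → 𝕜)
    (hasFDerivAt_prodMk_left (𝕜 := 𝕜) (0 : Fin r → 𝕜) b)

theorem continuousAt_leftDeriv : ContinuousAt G.leftDeriv 0 := by
  have h : ContinuousAt (fun b : Fin r → 𝕜 => (b, (0 : Fin r → 𝕜))) 0 :=
    continuousAt_id.prodMk continuousAt_const
  exact (ContinuousAt.comp (f := fun b : Fin r → 𝕜 => (b, (0 : Fin r → 𝕜)))
    G.analyticAt_mul.fderiv.continuousAt h).clm_comp continuousAt_const

theorem continuousAt_rightDeriv : ContinuousAt G.rightDeriv 0 := by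
  have h : ContinuousAt (fun b : Fin r → 𝕜 => ((0 : Fin r → 𝕜), b)) 0 :=
    continuousAt_const.prodMk continuousAt_id
  exact (ContinuousAt.comp (f := fun b : Fin r → 𝕜 => ((0 : Fin r → 𝕜), b))
    G.analyticAt_mul.fderiv.continuousAt h).clm_comp continuousAt_const

theorem leftDeriv_zero : G.leftDeriv 0 = ContinuousLinearMap.id 𝕜 _ :=
  G.eventually_hasFDerivAt_leftDeriv.self_of_nhds.unique
    ((hasFDerivAt_id _).congr_of_eventuallyEq G.zero_mul)

theorem rightDeriv_zero : G.rightDeriv 0 = ContinuousLinearMap.id 𝕜 _ :=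
  G.eventually_hasFDerivAt_rightDeriv.self_of_nhds.unique
    ((hasFDerivAt_id _).congr_of_eventuallyEq G.mul_zero)

/-- On each of the two axes the product with `0` is the identity map, so to first order
multiplication is addition. -/
theorem hasFDerivAt_mul : HasFDerivAt (fun p : (Fin r → 𝕜) × (Fin r → 𝕜) => G.mul p.1 p.2)
    (ContinuousLinearMap.fst 𝕜 (Fin r → 𝕜) (Fin r → 𝕜) +
      ContinuousLinearMap.snd 𝕜 (Fin r → 𝕜) (Fin r → 𝕜)) (0, 0) := by
  convert! G.analyticAt_mul.differentiableAt.hasFDerivAt using 1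
  ext1
  · ext1 v
    have h := DFunLike.congr_fun G.rightDeriv_zero v
    simpa using! h.symm
  · ext1 v
    have h := DFunLike.congr_fun G.leftDeriv_zero v
    simpa using! h.symm

/-- Analytic division on the right. -/
theorem exists_right_division : ∃ d : (Fin r → 𝕜) → (Fin r → 𝕜) → (Fin r → 𝕜),
    AnalyticAt 𝕜 (fun p : (Fin r → 𝕜) × (Fin r → 𝕜) => d p.1 p.2) (0, 0) ∧ d 0 0 = 0 ∧
      ∀ᶠ p in 𝓝 ((0, 0) : (Fin r → 𝕜) × (Fin r → 𝕜)), G.mul (d p.1 p.2) p.1 = p.2 := by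
  have h : AnalyticAt 𝕜 (fun p : (Fin r → 𝕜) × (Fin r → 𝕜) => G.mul p.2 p.1) (0, 0) :=
    analyticAt_mul_comp analyticAt_snd analyticAt_fst rfl rfl
  obtain ⟨d, h1, h2, -, h4⟩ := h.exists_family_inverse (g := fun a b => G.mul b a) G.mul_zero
  exact ⟨d, h1, h2, h4⟩

/-- If the zero set of a submersion is closed under multiplication near `0`, then it is a
continuous subgroup. -/
theorem exists_subgroup_of_zeros {Y : Type*} [NormedAddCommGroup Y] [NormedSpace 𝕜 Y]
    [FiniteDimensional 𝕜 Y] {P : (Fin r → 𝕜) → Y} (hP : AnalyticAt 𝕜 P 0) (hP0 : P 0 = 0)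
    (hs : Function.Surjective (fderiv 𝕜 P 0)) {m : ℕ}
    (hm : Module.finrank 𝕜 (LinearMap.ker (fderiv 𝕜 P 0).toLinearMap) = m)
    (hmul : ∀ᶠ p in 𝓝 ((0, 0) : (Fin r → 𝕜) × (Fin r → 𝕜)),
      P p.1 = 0 → P p.2 = 0 → P (G.mul p.1 p.2) = 0) :
    ∃ H : LocalLieSubgroup G m, (∀ᶠ w in 𝓝 0, P (H.incl w) = 0) ∧
      ∀ W ∈ 𝓝 (0 : Fin m → 𝕜), ∀ᶠ a in 𝓝 0, P a = 0 → ∃ y ∈ W, H.incl y = a := by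
  obtain ⟨Q, e, Ψ, -, hΨ, hΨ0, hΨd, hl, hr⟩ := hP.exists_adapted_coordinates hP0 hs hm
  have hQ0 : Q 0 = 0 := map_zero Q
  let ι : (Fin m → 𝕜) → (Fin r → 𝕜) := fun w => Ψ (0, w)
  have hι0 : ι 0 = 0 := hΨ0
  have hin : HasFDerivAt (fun w : Fin m → 𝕜 => ((0 : Y), w)) (ContinuousLinearMap.inr 𝕜 Y _) 0 :=
    hasFDerivAt_prodMk_right _ _
  have hι : AnalyticAt 𝕜 ι 0 :=
    AnalyticAt.fun_comp (f := fun w : Fin m → 𝕜 => ((0 : Y), w)) hΨ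
      (analyticAt_const.prod analyticAt_id)
  have hιd : HasFDerivAt ι ((e.symm : Y × (Fin m → 𝕜) →L[𝕜] (Fin r → 𝕜)).comp
      (ContinuousLinearMap.inr 𝕜 Y _)) 0 :=
    HasFDerivAt.comp (f := fun w : Fin m → 𝕜 => ((0 : Y), w)) 0 hΨd hin
  have htι : Tendsto ι (𝓝 0) (𝓝 0) := by simpa [hι0] using hι.continuousAt.tendsto
  have htQ : Tendsto Q (𝓝 0) (𝓝 0) := by simpa using Q.continuous.tendsto 0
  have hr' : ∀ᶠ w in 𝓝 0, P (ι w) = 0 ∧ Q (ι w) = w := hin.continuousAt.eventually hr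
  have hl' : ∀ᶠ a in 𝓝 0, P a = 0 → ι (Q a) = a := hl.mono fun a ha h => by
    rw [h] at ha; exact ha
  have t1 : Tendsto (fun p : (Fin m → 𝕜) × (Fin m → 𝕜) => p.1) (𝓝 (0, 0)) (𝓝 0) :=
    continuousAt_fst
  have t2 : Tendsto (fun p : (Fin m → 𝕜) × (Fin m → 𝕜) => p.2) (𝓝 (0, 0)) (𝓝 0) :=
    continuousAt_snd
  have hclosed : ∀ᶠ p in 𝓝 ((0, 0) : (Fin m → 𝕜) × (Fin m → 𝕜)),
      ι (Q (G.mul (ι p.1) (ι p.2))) = G.mul (ι p.1) (ι p.2) := by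
    have t1' := htι.comp t1
    have t2' := htι.comp t2
    filter_upwards [(t1'.prodMk_nhds t2').eventually hmul, t1.eventually hr', t2.eventually hr',
      (tendsto_mul t1' t2').eventually hl'] with x h1 h2 h3 h4
    exact h4 (h1 h2.1 h3.1)
  have s1 : Tendsto (fun p : (Fin m → 𝕜) × (Fin m → 𝕜) × (Fin m → 𝕜) => p.1)
    (𝓝 (0, 0, 0)) (𝓝 0) := continuousAt_fst
  have s' : Tendsto (fun p : (Fin m → 𝕜) × (Fin m → 𝕜) × (Fin m → 𝕜) => p.2)
    (𝓝 (0, 0, 0)) (𝓝 (0, 0)) := continuousAt_snd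
  have s2 := t1.comp s'
  have s3 := t2.comp s'
  -- The product is computed in `G` and read in the coordinates `Q` of the zero set; `hclosed` says
  -- that nothing is lost in doing so.
  let M : LocalLieGroup 𝕜 m :=
    { mul := fun v w => Q (G.mul (ι v) (ι w))
      analyticAt_mul := (Q.analyticAt _).fun_comp (analyticAt_mul_comp
        (AnalyticAt.fun_comp (f := Prod.fst) hι analyticAt_fst)
        (AnalyticAt.fun_comp (f := Prod.snd) hι analyticAt_snd) hι0 hι0)
      zero_mul := by
        filter_upwards [htι.eventually G.zero_mul, hr'] with w h1 h2
        rw [hι0, h1, h2.2]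
      mul_zero := by
        filter_upwards [htι.eventually G.mul_zero, hr'] with w h1 h2
        rw [hι0, h1, h2.2]
      mul_assoc := by
        filter_upwards [(s1.prodMk_nhds s2).eventually hclosed, (s2.prodMk_nhds s3).eventually hclosed,
          G.eventually_mul_assoc (htι.comp s1) (htι.comp s2) (htι.comp s3)] with p h1 h2 h3
        simp only [Function.comp] at h1 h2 h3
        rw [h1, h2, h3] }
  refine ⟨⟨M, ι, hι, hι0, ?_, hclosed⟩, hr'.mono fun w hw => hw.1, ?_⟩
  · rw [hιd.fderiv]
    intro v w hvw
    exact congrArg Prod.snd (e.symm.injective hvw)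
  · intro W hW
    filter_upwards [hl', htQ hW] with a h1 h2 h3
    exact ⟨Q a, h2, h1 h3⟩

end LocalLieGroup

/-! ### Local actions: kernel and stabilizer -/

/-- A local analytic action, not necessarily effective, of the local group `G` in `n` variables. -/
structure LocalAction {𝕜 : Type*} [RCLike 𝕜] {r : ℕ} (G : LocalLieGroup 𝕜 r) (n : ℕ) where
  base : Fin n → 𝕜
  act : (Fin n → 𝕜) → (Fin r → 𝕜) → (Fin n → 𝕜)
  analyticAt_act : AnalyticAt 𝕜
    (fun p : (Fin n → 𝕜) × (Fin r → 𝕜) => act p.1 p.2) (base, 0)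
  act_zero : ∀ᶠ x in 𝓝 base, act x 0 = x
  act_act : ∀ᶠ p in 𝓝 ((base, 0, 0) : (Fin n → 𝕜) × (Fin r → 𝕜) × (Fin r → 𝕜)),
    act (act p.1 p.2.1) p.2.2 = act p.1 (G.mul p.2.1 p.2.2)

namespace LocalAction

variable {𝕜 : Type*} [RCLike 𝕜] {r n : ℕ} {G : LocalLieGroup 𝕜 r} (φ : LocalAction G n)

/-- The transformation with parameters `a` is the identity near the base point. -/
def IsTrivialAt (a : Fin r → 𝕜) : Prop := ∀ᶠ x in 𝓝 φ.base, φ.act x a = x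

theorem act_base_zero : φ.act φ.base 0 = φ.base := φ.act_zero.self_of_nhds

theorem tendsto_act {α : Type*} {l : Filter α} {f : α → Fin n → 𝕜} {g : α → Fin r → 𝕜}
    (hf : Tendsto f l (𝓝 φ.base)) (hg : Tendsto g l (𝓝 0)) :
    Tendsto (fun x => φ.act (f x) (g x)) l (𝓝 φ.base) := by
  have h := φ.analyticAt_act.continuousAt.tendsto.comp (hf.prodMk_nhds hg)
  simpa only [φ.act_base_zero] using! h

theorem analyticAt_act_left {x : Fin n → 𝕜} {a : Fin r → 𝕜}
    (h : AnalyticAt 𝕜 (fun p : (Fin n → 𝕜) × (Fin r → 𝕜) => φ.act p.1 p.2) (x, a)) :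
    AnalyticAt 𝕜 (fun y => φ.act y a) x :=
  AnalyticAt.fun_comp (f := fun y : Fin n → 𝕜 => (y, a)) h (analyticAt_id.prod analyticAt_const)

theorem analyticAt_act_right {x : Fin n → 𝕜} {a : Fin r → 𝕜}
    (h : AnalyticAt 𝕜 (fun p : (Fin n → 𝕜) × (Fin r → 𝕜) => φ.act p.1 p.2) (x, a)) :
    AnalyticAt 𝕜 (fun b => φ.act x b) a :=
  AnalyticAt.fun_comp (f := fun b : Fin r → 𝕜 => (x, b)) h (analyticAt_const.prod analyticAt_id)

/-- Triviality of a transformation concerns germs at the base point, so the composition rule is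
needed with the parameters fixed before the neighbourhood of `x`. -/
theorem eventually_act_act_germ : ∀ᶠ p in 𝓝 ((0, 0) : (Fin r → 𝕜) × (Fin r → 𝕜)),
    ∀ᶠ x in 𝓝 φ.base, φ.act (φ.act x p.1) p.2 = φ.act x (G.mul p.1 p.2) := by
  have h : Tendsto (fun q : ((Fin r → 𝕜) × (Fin r → 𝕜)) × (Fin n → 𝕜) => (q.2, q.1))
    (𝓝 ((0, 0), φ.base)) (𝓝 (φ.base, 0, 0)) := continuous_swap.continuousAt
  exact (h.eventually φ.act_act).curry_nhds

theorem eventually_isTrivialAt_mul : ∀ᶠ p in 𝓝 ((0, 0) : (Fin r → 𝕜) × (Fin r → 𝕜)),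
    φ.IsTrivialAt p.1 → φ.IsTrivialAt p.2 → φ.IsTrivialAt (G.mul p.1 p.2) := by
  filter_upwards [φ.eventually_act_act_germ] with p h h1 h2
  filter_upwards [h, h1, h2] with x hx hx1 hx2
  rw [← hx, hx1, hx2]

/-- All the local data of an action hold on a polydisc of uniform size. -/
theorem exists_uniform_ball : ∃ ε > 0, ∀ x ∈ Metric.ball φ.base ε, φ.act x 0 = x ∧
    ∀ a ∈ Metric.ball (0 : Fin r → 𝕜) ε,
      AnalyticAt 𝕜 (fun p : (Fin n → 𝕜) × (Fin r → 𝕜) => φ.act p.1 p.2) (x, a) ∧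
      ∀ b ∈ Metric.ball (0 : Fin r → 𝕜) ε, φ.act (φ.act x a) b = φ.act x (G.mul a b) := by
  have h1 : Tendsto (fun q : (Fin n → 𝕜) × (Fin r → 𝕜) × (Fin r → 𝕜) => q.1)
    (𝓝 (φ.base, 0, 0)) (𝓝 φ.base) := continuousAt_fst
  have h2 : Tendsto (fun q : (Fin n → 𝕜) × (Fin r → 𝕜) × (Fin r → 𝕜) => (q.1, q.2.1))
    (𝓝 (φ.base, 0, 0)) (𝓝 (φ.base, 0)) :=
    (continuous_fst.prodMk (continuous_fst.comp continuous_snd)).continuousAt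
  obtain ⟨ε, hε, h⟩ := Metric.eventually_nhds_iff_ball.1 ((h1.eventually φ.act_zero).and
    ((h2.eventually φ.analyticAt_act.eventually_analyticAt).and φ.act_act))
  have hmem : ∀ x ∈ Metric.ball φ.base ε, ∀ a ∈ Metric.ball (0 : Fin r → 𝕜) ε,
      ∀ b ∈ Metric.ball (0 : Fin r → 𝕜) ε, (x, a, b) ∈ Metric.ball (φ.base, 0, 0) ε := by
    intro x hx a ha b hb
    rw [← ball_prod_same, ← ball_prod_same]
    exact ⟨hx, ha, hb⟩
  have h0 : (0 : Fin r → 𝕜) ∈ Metric.ball (0 : Fin r → 𝕜) ε := Metric.mem_ball_self hε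
  exact ⟨ε, hε, fun x hx => ⟨(h _ (hmem x hx 0 h0 0 h0)).1, fun a ha =>
    ⟨(h _ (hmem x hx a ha 0 h0)).2.1, fun b hb => (h _ (hmem x hx a ha b hb)).2.2⟩⟩⟩

/-- The identity theorem on the connected ball: the neighbourhood on which a trivial transformation
is the identity may be taken independent of the parameter. -/
theorem IsTrivialAt.act_eq {φ : LocalAction G n} {ε : ℝ} (hε : 0 < ε) {a : Fin r → 𝕜}
    (ha : φ.IsTrivialAt a) (h : ∀ x ∈ Metric.ball φ.base ε,
      AnalyticAt 𝕜 (fun p : (Fin n → 𝕜) × (Fin r → 𝕜) => φ.act p.1 p.2) (x, a)) :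
    ∀ x ∈ Metric.ball φ.base ε, φ.act x a = x :=
  AnalyticOnNhd.eqOn_of_preconnected_of_eventuallyEq (𝕜 := 𝕜) (f := fun x => φ.act x a)
    (g := fun x => x) (fun x hx => φ.analyticAt_act_left (h x hx)) (fun _ _ => analyticAt_id)
    (convex_ball φ.base ε).isPreconnected (Metric.mem_ball_self hε) ha

/-- The transformations `x ↦ f (x, a)` are injective near the base point, uniformly in `a`. -/
theorem eventually_act_injective : ∃ V ∈ 𝓝 φ.base, ∀ᶠ a in 𝓝 (0 : Fin r → 𝕜),
    ∀ x ∈ V, ∀ y ∈ V, φ.act x a = φ.act y a → x = y := by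
  have h : AnalyticAt 𝕜 (fun p : (Fin r → 𝕜) × (Fin n → 𝕜) => φ.act p.2 p.1) (0, φ.base) :=
    AnalyticAt.fun_comp (g := fun p : (Fin n → 𝕜) × (Fin r → 𝕜) => φ.act p.1 p.2) (f := Prod.swap)
      φ.analyticAt_act (analyticAt_snd.prod analyticAt_fst)
  obtain ⟨d, -, -, h3, -⟩ := h.exists_family_inverse (g := fun a x => φ.act x a) φ.act_zero
  rw [nhds_prod_eq] at h3
  obtain ⟨p, hp, q, hq, hpq⟩ := eventually_prod_iff.1 h3
  refine ⟨_, hq, hp.mono fun a ha x hx y hy hxy => ?_⟩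
  have h1 := hpq ha hx
  have h2 := hpq ha hy
  simp only at h1 h2
  rw [← h1, hxy, h2]

/-- The parameters of the transformations that are the identity form a continuous subgroup. -/
theorem exists_kernel : ∃ (k : ℕ) (N : LocalLieSubgroup G k),
    (∀ᶠ w in 𝓝 0, φ.IsTrivialAt (N.incl w)) ∧
    ∀ W ∈ 𝓝 (0 : Fin k → 𝕜), ∀ᶠ a in 𝓝 0, φ.IsTrivialAt a → ∃ y ∈ W, N.incl y = a := by
  obtain ⟨ε, hε, hball⟩ := φ.exists_uniform_ball
  set B := Metric.ball φ.base ε with hB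
  set D : (Fin n → 𝕜) → (Fin r → 𝕜) →L[𝕜] (Fin n → 𝕜) :=
    fun x => fderiv 𝕜 (fun a => φ.act x a) 0 with hD
  -- Finitely many points already detect every infinitesimal transformation that vanishes on `B`;
  -- the map `f` below, with values in a finite-dimensional space, records only their displacements.
  obtain ⟨t, htB, ht⟩ := LinearMap.exists_finset_common_kernel (fun x => (D x).toLinearMap) B
  have hBn : B ∈ 𝓝 φ.base := Metric.ball_mem_nhds _ hε
  have hε0 : Metric.ball (0 : Fin r → 𝕜) ε ∈ 𝓝 0 := Metric.ball_mem_nhds _ hε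
  have h0 : (0 : Fin r → 𝕜) ∈ Metric.ball (0 : Fin r → 𝕜) ε := Metric.mem_ball_self hε
  have hdiff : ∀ x ∈ B, ∀ a ∈ Metric.ball (0 : Fin r → 𝕜) ε,
      AnalyticAt 𝕜 (fun b => φ.act x b) a :=
    fun x hx a ha => φ.analyticAt_act_right ((hball x hx).2 a ha).1
  have hact : ∀ᶠ p in 𝓝 (φ.base, (0 : Fin r → 𝕜)), φ.act p.1 p.2 ∈ B :=
    (φ.tendsto_act (l := 𝓝 (φ.base, (0 : Fin r → 𝕜))) (f := Prod.fst) (g := Prod.snd)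
      continuous_fst.continuousAt continuous_snd.continuousAt).eventually hBn
  rw [nhds_prod_eq] at hact
  -- A product neighbourhood: the condition `q'` on `b` must not depend on `x`, since one set `V`
  -- serves all `x` near the base point.
  obtain ⟨q, hq, q', hq', hqq'⟩ := eventually_prod_iff.1 hact
  have htact : ∀ᶠ b in 𝓝 (0 : Fin r → 𝕜), ∀ x ∈ t, φ.act x b ∈ B := by
    rw [eventually_all_finset]
    intro x hx
    refine (hdiff x (htB hx) 0 h0).continuousAt.eventually_mem ?_
    rw [(hball x (htB hx)).1]
    exact Metric.isOpen_ball.mem_nhds (htB hx)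
  let V : Set (Fin r → 𝕜) := {b | b ∈ Metric.ball 0 ε ∧ q' b ∧ (∀ x ∈ t, φ.act x b ∈ B) ∧
    HasFDerivAt (fun c => G.mul b c) (G.leftDeriv b) 0 ∧ G.mul b 0 = b}
  have hV : V ∈ 𝓝 0 := (eventually_mem_set.2 hε0).and (hq'.and (htact.and
    (G.eventually_hasFDerivAt_leftDeriv.and G.mul_zero)))
  -- Differentiate `f(f(x, b), c) = f(x, b c)` in `c` at `0`. The left side gives `D (f(x, b)) v`,
  -- which vanishes because `f(x, b)` lies in `B`.
  have hkey : ∀ x ∈ B, ∀ b ∈ V, φ.act x b ∈ B → ∀ v, (∀ y ∈ t, D y v = 0) →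
      fderiv 𝕜 (fun a => φ.act x a) b (G.leftDeriv b v) = 0 := by
    rintro x hx b ⟨hb1, -, -, hb4, hb5⟩ hxb v hv
    have e1 : HasFDerivAt (fun c => φ.act (φ.act x b) c) (D (φ.act x b)) 0 :=
      (hdiff _ hxb 0 h0).differentiableAt.hasFDerivAt
    have e2 : HasFDerivAt (fun a => φ.act x a) (fderiv 𝕜 (fun a => φ.act x a) b) (G.mul b 0) := by
      rw [hb5]
      exact (hdiff x hx b hb1).differentiableAt.hasFDerivAt
    have e3 := (e2.comp (0 : Fin r → 𝕜) hb4).congr_of_eventuallyEq (f₁ := fun c => φ.act (φ.act x b) c)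
      (Filter.mem_of_superset hε0 fun c hc => ((hball x hx).2 b hb1).2 c hc)
    exact (DFunLike.congr_fun (e3.unique e1) v).trans (ht v hv _ hxb)
  let f : (Fin r → 𝕜) → (t → Fin n → 𝕜) := fun a x => φ.act x a - x
  have hf : ∀ b ∈ Metric.ball (0 : Fin r → 𝕜) ε, AnalyticAt 𝕜 f b := fun b hb =>
    AnalyticAt.pi fun x => (hdiff x (htB x.2) b hb).fun_sub analyticAt_const
  have hf0 : f 0 = 0 := funext fun x => by simp [f, (hball x (htB x.2)).1]
  have hfd : ∀ b ∈ Metric.ball (0 : Fin r → 𝕜) ε, ∀ v x,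
      fderiv 𝕜 f b v x = fderiv 𝕜 (fun a => φ.act x a) b v := by
    intro b hb v x
    have h1 : HasFDerivAt f (ContinuousLinearMap.pi fun x : t => fderiv 𝕜 (fun a => φ.act x a) b) b :=
      hasFDerivAt_pi.2 fun x =>
        ((hdiff x (htB x.2) b hb).differentiableAt.hasFDerivAt).sub_const _
    rw [h1.fderiv]
    rfl
  have hker : ∀ v, fderiv 𝕜 f 0 v = 0 → ∀ y ∈ t, D y v = 0 := fun v hv y hy => by
    have := congrFun hv ⟨y, hy⟩
    rwa [hfd 0 h0] at this
  obtain ⟨p, -, hP, hPs, -, U, hU, hfib⟩ := (hf 0 h0).exists_projection_eq_on_fibres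
    (F := Fin n → 𝕜) hf0 G.continuousAt_leftDeriv G.leftDeriv_zero hV (fun b hb =>
      ⟨(hf b hb.1).differentiableAt, fun v hv => funext fun x => by
        rw [hfd b hb.1]
        exact hkey x (htB x.2) b hb (hb.2.2.1 x x.2) v (hker v hv)⟩)
  -- If `p (f a) = 0`, then `a` and `0` lie on one fibre, so `f(x, a) = f(x, 0) = x` for all `x`
  -- near the base point, the set `U` being independent of `x`. Conversely, a trivial `a` fixes the
  -- points of `t` by the identity theorem.
  have hiff : ∀ᶠ a in 𝓝 (0 : Fin r → 𝕜), p (f a) = 0 ↔ φ.IsTrivialAt a := by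
    filter_upwards [hU, hε0] with a haU haε
    constructor
    · intro ha
      filter_upwards [hq, hBn] with x hx hxB
      have h1 := hfib (fun b => φ.act x b) (fun b hb => ⟨(hdiff x hxB b hb.1).differentiableAt,
        fun v hv => hkey x hxB b hb (hqq' hx hb.2.1) v (hker v hv)⟩) a haU 0 (mem_of_mem_nhds hU)
        (by rw [ha, hf0, map_zero])
      exact h1.trans (hball x hxB).1
    · intro ha
      have h1 : f a = 0 := funext fun x => by
        have := ha.act_eq hε (fun x hx => ((hball x hx).2 a haε).1) x (htB x.2)
        simp [f, this]
      rw [h1, map_zero]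
  have t1 : Tendsto (fun p : (Fin r → 𝕜) × (Fin r → 𝕜) => p.1) (𝓝 (0, 0)) (𝓝 0) :=
    continuousAt_fst
  have t2 : Tendsto (fun p : (Fin r → 𝕜) × (Fin r → 𝕜) => p.2) (𝓝 (0, 0)) (𝓝 0) :=
    continuousAt_snd
  obtain ⟨N, hN1, hN2⟩ := G.exists_subgroup_of_zeros hP (by rw [hf0, map_zero]) hPs rfl (by
    filter_upwards [φ.eventually_isTrivialAt_mul, t1.eventually hiff, t2.eventually hiff,
      (LocalLieGroup.tendsto_mul t1 t2).eventually hiff] with c h1 h2 h3 h4 h5 h6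
    exact h4.2 (h1 (h2.1 h5) (h3.1 h6)))
  have hι : Tendsto N.incl (𝓝 0) (𝓝 0) := by
    simpa [N.incl_zero] using N.analyticAt_incl.continuousAt.tendsto
  refine ⟨_, N, ?_, fun W hW => ?_⟩
  · filter_upwards [hN1, hι.eventually hiff] with w h1 h2 using h2.1 h1
  · filter_upwards [hN2 W hW, hiff] with a h1 h2 h3 using h1 (h2.2 h3)

/-- The kernel of an action is a normal subgroup. -/
theorem isNormal_of_kernel {k : ℕ} (N : LocalLieSubgroup G k)
    (h1 : ∀ᶠ w in 𝓝 0, φ.IsTrivialAt (N.incl w))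
    (h2 : ∀ W ∈ 𝓝 (0 : Fin k → 𝕜), ∀ᶠ a in 𝓝 0, φ.IsTrivialAt a → ∃ y ∈ W, N.incl y = a) :
    N.IsNormal := by
  intro W hW
  obtain ⟨d, hd, hd0, hdm⟩ := G.exists_right_division
  obtain ⟨ε, hε, hball⟩ := φ.exists_uniform_ball
  obtain ⟨V, hV, hinj⟩ := φ.eventually_act_injective
  have hι : Tendsto N.incl (𝓝 0) (𝓝 0) := by
    simpa [N.incl_zero] using N.analyticAt_incl.continuousAt.tendsto
  have t1 : Tendsto (fun p : (Fin r → 𝕜) × (Fin k → 𝕜) => p.1) (𝓝 (0, 0)) (𝓝 0) :=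
    continuousAt_fst
  have t2 : Tendsto (fun p : (Fin r → 𝕜) × (Fin k → 𝕜) => p.2) (𝓝 (0, 0)) (𝓝 0) :=
    continuousAt_snd
  have t3 : Tendsto (fun p : (Fin r → 𝕜) × (Fin k → 𝕜) => N.incl p.2) (𝓝 (0, 0)) (𝓝 0) :=
    hι.comp t2
  have t4 := LocalLieGroup.tendsto_mul (G := G) t1 t3
  have t5 : Tendsto (fun p : (Fin r → 𝕜) × (Fin k → 𝕜) => d p.1 (G.mul p.1 (N.incl p.2)))
      (𝓝 (0, 0)) (𝓝 0) := by
    have h := hd.continuousAt.tendsto.comp (t1.prodMk_nhds t4)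
    simp only [hd0] at h
    exact h
  have hεn : ∀ᶠ a in 𝓝 (0 : Fin r → 𝕜), a ∈ Metric.ball 0 ε := Metric.ball_mem_nhds _ hε
  have hcont : ∀ᶠ a in 𝓝 (0 : Fin r → 𝕜), ∀ᶠ x in 𝓝 φ.base, φ.act x a ∈ Metric.ball φ.base ε := by
    have h : Tendsto (fun q : (Fin r → 𝕜) × (Fin n → 𝕜) => φ.act q.2 q.1) (𝓝 (0, φ.base))
      (𝓝 φ.base) := φ.tendsto_act continuousAt_snd continuousAt_fst
    exact (h.eventually (Metric.ball_mem_nhds _ hε)).curry_nhds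
  have hcontV : ∀ᶠ a in 𝓝 (0 : Fin r → 𝕜), ∀ᶠ x in 𝓝 φ.base, φ.act x a ∈ V := by
    have h : Tendsto (fun q : (Fin r → 𝕜) × (Fin n → 𝕜) => φ.act q.2 q.1) (𝓝 (0, φ.base))
      (𝓝 φ.base) := φ.tendsto_act continuousAt_snd continuousAt_fst
    exact (h.eventually hV).curry_nhds
  filter_upwards [t2.eventually h1, t5.eventually (h2 W hW), (t1.prodMk_nhds t4).eventually hdm,
    (t5.prodMk_nhds t1).eventually φ.eventually_act_act_germ,
    (t1.prodMk_nhds t3).eventually φ.eventually_act_act_germ, t3.eventually hεn,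
    t1.eventually hcont, t5.eventually hcontV, t1.eventually hinj]
    with c e1 e2 e3 e4 e5 e6 e7 e8 e9
  -- The conjugate `d` with `d c = c x` is trivial: applying `d` and then `c` amounts to applying
  -- `c` and then the trivial `x`, that is, to `c` alone, and the transformation `c` is injective.
  obtain ⟨y, hyW, hy⟩ := e2 (by
    filter_upwards [e4, e5, e7, e8, hV] with x x4 x5 x7 x8 x9
    refine e9 _ x8 _ x9 ?_
    rw [x4, e3, ← x5]
    exact e1.act_eq hε (fun x hx => ((hball x hx).2 _ e6).1) _ x7)
  exact ⟨y, hyW, by rw [hy, e3]⟩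

/-- The stabilizer of the base point under a transitive action. -/
theorem exists_stabilizer (ht : ∀ V ∈ 𝓝 (0 : Fin r → 𝕜), φ.act φ.base '' V ∈ 𝓝 φ.base) :
    ∃ m, m + n = r ∧ ∃ H : LocalLieSubgroup G m, ∀ᶠ w in 𝓝 0, φ.act φ.base (H.incl w) = φ.base := by
  obtain ⟨ε, hε, hball⟩ := φ.exists_uniform_ball
  have hε0 : Metric.ball (0 : Fin r → 𝕜) ε ∈ 𝓝 0 := Metric.ball_mem_nhds _ hε
  have h0 : (0 : Fin r → 𝕜) ∈ Metric.ball (0 : Fin r → 𝕜) ε := Metric.mem_ball_self hε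
  have hb : φ.base ∈ Metric.ball φ.base ε := Metric.mem_ball_self hε
  let f : (Fin r → 𝕜) → (Fin n → 𝕜) := fun a => φ.act φ.base a - φ.base
  have hf : ∀ b ∈ Metric.ball (0 : Fin r → 𝕜) ε, AnalyticAt 𝕜 f b := fun b hb' =>
    (φ.analyticAt_act_right ((hball _ hb).2 b hb').1).fun_sub analyticAt_const
  have hf0 : f 0 = 0 := by simp [f, φ.act_base_zero]
  let V : Set (Fin r → 𝕜) := {b | b ∈ Metric.ball 0 ε ∧
    HasFDerivAt (fun c => G.mul c b) (G.rightDeriv b) 0 ∧ G.mul 0 b = b}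
  have hV : V ∈ 𝓝 0 := (eventually_mem_set.2 hε0).and
    (G.eventually_hasFDerivAt_rightDeriv.and G.zero_mul)
  -- Differentiate `f(x₀, c b) = f(f(x₀, c), b)` in `c` at `0`. Only the base point is followed
  -- here, so right translations serve, whereas the kernel required left ones.
  have hkey : ∀ b ∈ V, ∀ v, fderiv 𝕜 f 0 v = 0 → fderiv 𝕜 f b (G.rightDeriv b v) = 0 := by
    rintro b ⟨hb1, hb2, hb3⟩ v hv
    have e1 : HasFDerivAt (fun c => f c + φ.base) (fderiv 𝕜 f 0) 0 :=
      (hf 0 h0).differentiableAt.hasFDerivAt.add_const _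
    have e2 : HasFDerivAt (fun x => φ.act x b) (fderiv 𝕜 (fun x => φ.act x b) φ.base)
        (f 0 + φ.base) := by
      rw [hf0, zero_add]
      exact (φ.analyticAt_act_left ((hball _ hb).2 b hb1).1).differentiableAt.hasFDerivAt
    have e3 : HasFDerivAt f (fderiv 𝕜 f b) (G.mul 0 b) := by
      rw [hb3]
      exact (hf b hb1).differentiableAt.hasFDerivAt
    have e4 := (e3.comp (0 : Fin r → 𝕜) hb2).add_const φ.base
    have e5 := (e2.comp (0 : Fin r → 𝕜) e1).congr_of_eventuallyEq
      (f₁ := fun c => f (G.mul c b) + φ.base) (by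
        filter_upwards [hε0] with c hc
        simp only [f, sub_add_cancel, Function.comp]
        exact (((hball _ hb).2 c hc).2 b hb1).symm)
    refine (DFunLike.congr_fun (e4.unique e5) v).trans ?_
    change fderiv 𝕜 (fun x => φ.act x b) φ.base (fderiv 𝕜 f 0 v) = 0
    rw [hv, map_zero]
  obtain ⟨p, hp, hP, -, -, U, hU, hfib⟩ := (hf 0 h0).exists_projection_eq_on_fibres
    (F := Fin n → 𝕜) hf0 G.continuousAt_rightDeriv G.rightDeriv_zero hV
    (fun b hb => ⟨(hf b hb.1).differentiableAt, hkey b hb⟩)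
  -- Transitivity forces full rank. Otherwise some `u ≠ 0` has `p u = 0`, and a point `x₀ + c u`
  -- with `c ≠ 0` small is reached by some `a` in `U`. Then `a` and `0` lie on one fibre, so `f a =
  -- f 0 = 0`, although `f a = c u`.
  have hsurj : Function.Surjective (fderiv 𝕜 f 0) := by
    by_contra hns
    simp only [Function.Surjective, not_forall] at hns
    obtain ⟨x, hx⟩ := hns
    set u := x - (p x : Fin n → 𝕜) with hu
    have hpu : p u = 0 := by rw [hu, map_sub, hp, sub_self]
    have hu0 : u ≠ 0 := fun h => hx (by
      obtain ⟨v, hv⟩ := (p x).2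
      exact ⟨v, hv.trans (sub_eq_zero.1 h).symm⟩)
    have hlim : Tendsto (fun c : 𝕜 => φ.base + c • u) (𝓝[≠] 0) (𝓝 φ.base) := by
      have : Continuous fun c : 𝕜 => φ.base + c • u := by fun_prop
      simpa using (this.tendsto 0).mono_left nhdsWithin_le_nhds
    obtain ⟨c, ⟨a, haU, ha⟩, hc⟩ := ((hlim.eventually (ht U hU)).and self_mem_nhdsWithin).exists
    have hfa : f a = c • u := by simp [f, ha]
    have := hfib f (fun b hb => ⟨(hf b hb.1).differentiableAt, hkey b hb⟩) a haU 0
      (mem_of_mem_nhds hU) (by rw [hfa, hf0, map_smul, hpu, smul_zero, map_zero])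
    rw [hfa, hf0] at this
    exact (smul_ne_zero hc hu0) this
  obtain ⟨H, hH, -⟩ := G.exists_subgroup_of_zeros (hf 0 h0) hf0 hsurj rfl (by
    have hεn : ∀ᶠ c in 𝓝 ((0, 0) : (Fin r → 𝕜) × (Fin r → 𝕜)),
        c ∈ Metric.ball (0 : Fin r → 𝕜) ε ×ˢ Metric.ball (0 : Fin r → 𝕜) ε :=
      prod_mem_nhds hε0 hε0
    filter_upwards [hεn] with c hc h1 h2
    have h3 := ((hball _ hb).2 c.1 hc.1).2 c.2 hc.2
    rw [sub_eq_zero.1 h1, sub_eq_zero.1 h2] at h3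
    exact sub_eq_zero.2 h3.symm)
  refine ⟨_, ?_, H, hH.mono fun w hw => sub_eq_zero.1 hw⟩
  have h1 := LinearMap.finrank_range_add_finrank_ker (fderiv 𝕜 f 0).toLinearMap
  rw [LinearMap.range_eq_top.2 hsurj, finrank_top] at h1
  simp only [Module.finrank_fin_fun] at h1
  rw [add_comm]
  exact h1

/-- A normal subgroup in the stabilizer of the base point of a transitive action acts trivially. -/
theorem eventually_isTrivialAt_of_isNormal
    (ht : ∀ V ∈ 𝓝 (0 : Fin r → 𝕜), φ.act φ.base '' V ∈ 𝓝 φ.base)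
    {k m : ℕ} {N : LocalLieSubgroup G k} {H : LocalLieSubgroup G m} (hN : N.IsNormal)
    (hNH : N.IsContainedIn H) (hH : ∀ᶠ w in 𝓝 0, φ.act φ.base (H.incl w) = φ.base) :
    ∀ᶠ x in 𝓝 0, φ.IsTrivialAt (N.incl x) := by
  have hfix : ∀ᶠ x in 𝓝 0, φ.act φ.base (N.incl x) = φ.base := by
    filter_upwards [hNH _ hH] with x ⟨y, hy, hyx⟩
    rw [← hyx]
    exact hy
  obtain ⟨ε, hε, hball⟩ := φ.exists_uniform_ball
  have hε0 : Metric.ball (0 : Fin r → 𝕜) ε ∈ 𝓝 0 := Metric.ball_mem_nhds _ hε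
  have hb : φ.base ∈ Metric.ball φ.base ε := Metric.mem_ball_self hε
  have hι : Tendsto N.incl (𝓝 0) (𝓝 0) := by
    simpa [N.incl_zero] using N.analyticAt_incl.continuousAt.tendsto
  have h1 := hN _ (hfix.and (hι.eventually hε0))
  rw [nhds_prod_eq] at h1
  -- The range `q` of `a` is independent of `x`, so for each fixed `x` the points `x₀ a` fill a
  -- neighbourhood of the base point.
  obtain ⟨q, hq, q', hq', hqq'⟩ := eventually_prod_iff.1 h1
  filter_upwards [hq', hι.eventually hε0] with x hx hxε
  filter_upwards [ht _ (hq.and hε0)] with z hz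
  obtain ⟨a, ⟨haq, haε⟩, rfl⟩ := hz
  obtain ⟨y, ⟨hy1, hy2⟩, hy⟩ := hqq' haq hx
  simp only at hy
  rw [((hball _ hb).2 a haε).2 _ hxε, hy, ← ((hball _ hb).2 _ hy2).2 a haε, hy1]

end LocalAction

/-! ### Coset actions and change of parameters -/

section

variable {𝕜 : Type*} [RCLike 𝕜] {r : ℕ}

/-- The action of a local group on the space of cosets of a continuous subgroup. -/
theorem LocalLieSubgroup.exists_coset_action {G : LocalLieGroup 𝕜 r} {m s : ℕ}
    (H : LocalLieSubgroup G m) (hms : m + s = r) :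
    ∃ φ : LocalAction G s,
      (∀ V ∈ 𝓝 (0 : Fin r → 𝕜), φ.act φ.base '' V ∈ 𝓝 φ.base) ∧
      ∀ W ∈ 𝓝 (0 : Fin m → 𝕜), ∀ᶠ a in 𝓝 0, φ.act φ.base a = φ.base → ∃ y ∈ W, H.incl y = a := by
  obtain ⟨σ, e, he⟩ := (fderiv 𝕜 H.incl 0).exists_complement H.injective_fderiv
    (s := s) (by simp [hms])
  have hσ0 : σ 0 = 0 := map_zero σ
  have hι0 := H.incl_zero
  have hι : Tendsto H.incl (𝓝 0) (𝓝 0) := by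
    simpa [hι0] using H.analyticAt_incl.continuousAt.tendsto
  have hσ : Tendsto σ (𝓝 0) (𝓝 0) := by simpa using σ.continuous.tendsto 0
  -- Near `0` each `c` factors uniquely as `h · σ x` with small `h` in `H` and small `x`. Thus `x`,
  -- the second component of the inverse `g`, is a coordinate of the coset `Hc`.
  let M : (Fin m → 𝕜) × (Fin s → 𝕜) → (Fin r → 𝕜) := fun p => G.mul (H.incl p.1) (σ p.2)
  have hM : AnalyticAt 𝕜 M (0, 0) := LocalLieGroup.analyticAt_mul_comp
    (AnalyticAt.fun_comp (f := Prod.fst) H.analyticAt_incl analyticAt_fst)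
    ((σ.analyticAt _).fun_comp analyticAt_snd) hι0 hσ0
  have hM0 : M (0, 0) = 0 := by simp [M, hι0, G.mul_zero_zero]
  have hMd : HasFDerivAt M (e : (Fin m → 𝕜) × (Fin s → 𝕜) →L[𝕜] (Fin r → 𝕜)) (0, 0) := by
    have h1 : HasFDerivAt (fun p : (Fin m → 𝕜) × (Fin s → 𝕜) => H.incl p.1)
        ((fderiv 𝕜 H.incl 0).comp (ContinuousLinearMap.fst 𝕜 _ _)) (0, 0) :=
      HasFDerivAt.comp (f := Prod.fst) ((0, 0) : (Fin m → 𝕜) × (Fin s → 𝕜))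
        H.analyticAt_incl.differentiableAt.hasFDerivAt hasFDerivAt_fst
    have h2 : HasFDerivAt (fun p : (Fin m → 𝕜) × (Fin s → 𝕜) => σ p.2)
        (σ.comp (ContinuousLinearMap.snd 𝕜 _ _)) (0, 0) :=
      HasFDerivAt.comp (f := Prod.snd) ((0, 0) : (Fin m → 𝕜) × (Fin s → 𝕜))
        σ.hasFDerivAt hasFDerivAt_snd
    have h3 : HasFDerivAt (fun p : (Fin r → 𝕜) × (Fin r → 𝕜) => G.mul p.1 p.2)
        (ContinuousLinearMap.fst 𝕜 (Fin r → 𝕜) (Fin r → 𝕜) +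
          ContinuousLinearMap.snd 𝕜 (Fin r → 𝕜) (Fin r → 𝕜)) (H.incl 0, σ 0) := by
      rw [hι0, hσ0]
      exact G.hasFDerivAt_mul
    rw [he]
    exact HasFDerivAt.comp (f := fun p : (Fin m → 𝕜) × (Fin s → 𝕜) => (H.incl p.1, σ p.2))
      ((0, 0) : (Fin m → 𝕜) × (Fin s → 𝕜)) h3 (h1.prodMk h2)
  obtain ⟨g, hg, hg0, hgM, hMg⟩ := hM.exists_local_inverse e hMd
  rw [hM0] at hg hg0 hMg
  have hgt : Tendsto g (𝓝 0) (𝓝 (0, 0)) := by simpa only [hg0] using hg.continuousAt.tendsto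
  have hη : Tendsto (fun c => (g c).1) (𝓝 0) (𝓝 0) := (continuousAt_fst (p := (0, 0))).tendsto.comp hgt
  have hπ : Tendsto (fun c => (g c).2) (𝓝 0) (𝓝 0) := (continuousAt_snd (p := (0, 0))).tendsto.comp hgt
  have hπσ : ∀ᶠ x in 𝓝 0, (g (σ x)).2 = x := by
    have h : Tendsto (fun x : Fin s → 𝕜 => ((0 : Fin m → 𝕜), x)) (𝓝 0) (𝓝 (0, 0)) :=
      tendsto_const_nhds.prodMk_nhds tendsto_id
    filter_upwards [h.eventually hgM, hσ.eventually G.zero_mul] with x h1 h2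
    simp only [M, hι0, h2] at h1
    rw [h1]
  let act : (Fin s → 𝕜) → (Fin r → 𝕜) → (Fin s → 𝕜) := fun x a => (g (G.mul (σ x) a)).2
  have hact : AnalyticAt 𝕜 (fun p : (Fin s → 𝕜) × (Fin r → 𝕜) => act p.1 p.2) (0, 0) := by
    have h1 : AnalyticAt 𝕜 (fun p : (Fin s → 𝕜) × (Fin r → 𝕜) => G.mul (σ p.1) p.2) (0, 0) :=
      LocalLieGroup.analyticAt_mul_comp ((σ.analyticAt _).fun_comp analyticAt_fst)
        analyticAt_snd hσ0 rfl
    have h2 : AnalyticAt 𝕜 g (G.mul (σ 0) 0) := by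
      rw [hσ0, G.mul_zero_zero]; exact hg
    exact analyticAt_snd.fun_comp (AnalyticAt.fun_comp
      (f := fun p : (Fin s → 𝕜) × (Fin r → 𝕜) => G.mul (σ p.1) p.2) (x := (0, 0)) h2 h1)
  have hact0 : ∀ᶠ a in 𝓝 0, act 0 a = (g a).2 := G.zero_mul.mono fun a ha => by
    simp only [act, hσ0, ha]
  have hgz : (g 0).2 = 0 := congrArg Prod.snd hg0
  refine ⟨⟨0, act, hact, ?_, ?_⟩, fun V hV => ?_, fun W hW => ?_⟩
  · filter_upwards [hσ.eventually G.mul_zero, hπσ] with x h1 h2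
    simp only [act, h1, h2]
  · have t1 : Tendsto (fun p : (Fin s → 𝕜) × (Fin r → 𝕜) × (Fin r → 𝕜) => σ p.1)
      (𝓝 (0, 0, 0)) (𝓝 0) := hσ.comp continuousAt_fst
    have t' : Tendsto (fun p : (Fin s → 𝕜) × (Fin r → 𝕜) × (Fin r → 𝕜) => p.2)
      (𝓝 (0, 0, 0)) (𝓝 (0, 0)) := continuousAt_snd
    have t2 : Tendsto (fun p : (Fin s → 𝕜) × (Fin r → 𝕜) × (Fin r → 𝕜) => p.2.1)
      (𝓝 (0, 0, 0)) (𝓝 0) := (continuousAt_fst (p := (0, 0))).tendsto.comp t'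
    have t3 : Tendsto (fun p : (Fin s → 𝕜) × (Fin r → 𝕜) × (Fin r → 𝕜) => p.2.2)
      (𝓝 (0, 0, 0)) (𝓝 0) := (continuousAt_snd (p := (0, 0))).tendsto.comp t'
    have tc := LocalLieGroup.tendsto_mul (G := G) t1 t2
    have tηc := hη.comp tc
    have tπc := hπ.comp tc
    have td := LocalLieGroup.tendsto_mul (G := G) (hσ.comp tπc) t3
    have tηd := hη.comp td
    have tπd := hπ.comp td
    have thh := LocalLieGroup.tendsto_mul (G := H.group) tηc tηd
    -- With `σ x · a = h₁ σ x₁` and `σ x₁ · b = h₂ σ x₂`, associativity gives `σ x · (a b) = (h₁ h₂)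
    -- σ x₂`. As `h₁ h₂` is again in `H`, the coset coordinate is `x₂`.
    filter_upwards [tc.eventually hMg, td.eventually hMg, G.eventually_mul_assoc t1 t2 t3,
      G.eventually_mul_assoc (hι.comp tηc) (hσ.comp tπc) t3,
      G.eventually_mul_assoc (hι.comp tηc) (hι.comp tηd) (hσ.comp tπd),
      (tηc.prodMk_nhds tηd).eventually H.incl_mul, (thh.prodMk_nhds tπd).eventually hgM]
      with p h1 h2 h3 h4 h5 h6 h7
    simp only [Function.comp, M, act] at h1 h2 h3 h4 h5 h6 h7 ⊢
    rw [h1] at h4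
    rw [h6, h5, h2, ← h4, h3] at h7
    rw [h7]
  · filter_upwards [hπσ, hσ hV, hσ.eventually hact0] with x h1 h2 h3
    exact ⟨σ x, h2, h3.trans h1⟩
  · filter_upwards [hact0, hMg, hη.eventually_mem hW,
      (hι.comp hη).eventually G.mul_zero] with a h1 h2 h3 h4 h5
    refine ⟨(g a).1, h3, ?_⟩
    have h6 : (g a).2 = 0 := h1.symm.trans h5
    simp only [M, h6, hσ0] at h2
    exact h4.symm.trans h2

theorem LocalLieGroup.locallyIsomorphic_refl (G : LocalLieGroup 𝕜 r) : G.LocallyIsomorphic G :=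
  ⟨id, id, analyticAt_id, analyticAt_id, rfl, rfl, .of_forall fun _ => rfl,
    .of_forall fun _ => rfl, .of_forall fun _ => rfl⟩

/-- A subgroup whose elements near the identity all vanish has order `0`. -/
theorem LocalLieSubgroup.order_eq_zero {G : LocalLieGroup 𝕜 r} {k : ℕ} (N : LocalLieSubgroup G k)
    (h : ∀ᶠ x in 𝓝 0, N.incl x = 0) : k = 0 := by
  have hd : HasFDerivAt N.incl (0 : (Fin k → 𝕜) →L[𝕜] (Fin r → 𝕜)) 0 :=
    (hasFDerivAt_const 0 0).congr_of_eventuallyEq h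
  have hinj := N.injective_fderiv
  rw [hd.fderiv] at hinj
  by_contra hk
  have h1 : (1 : Fin k → 𝕜) = 0 := hinj rfl
  exact one_ne_zero (congrFun h1 ⟨0, Nat.pos_of_ne_zero hk⟩)

/-- The transformations of a group can be reparametrized by an isomorphic group. -/
theorem LocalLieGroup.LocallyIsomorphic.exists_action {r' s : ℕ} {G : LocalLieGroup 𝕜 r}
    {Γ : ContTransGroup 𝕜 s r'} (h : G.LocallyIsomorphic Γ.group) (ht : Γ.IsTransitive) :
    ∃ φ : LocalAction G s,
      (∀ V ∈ 𝓝 (0 : Fin r → 𝕜), φ.act φ.base '' V ∈ 𝓝 φ.base) ∧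
      ∀ᶠ a in 𝓝 0, φ.IsTrivialAt a → a = 0 := by
  obtain ⟨θ, η, hθ, hη, hθ0, hη0, h1, h2, h3⟩ := h
  have tθ : Tendsto θ (𝓝 0) (𝓝 0) := by simpa [hθ0] using hθ.continuousAt.tendsto
  have tη : Tendsto η (𝓝 0) (𝓝 0) := by simpa [hη0] using hη.continuousAt.tendsto
  have hact : AnalyticAt 𝕜 (fun p : (Fin s → 𝕜) × (Fin r → 𝕜) => Γ.act p.1 (θ p.2))
      (Γ.base, 0) := by
    have e1 : AnalyticAt 𝕜 (fun p : (Fin s → 𝕜) × (Fin r' → 𝕜) => Γ.act p.1 p.2)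
        (Γ.base, θ 0) := by rw [hθ0]; exact Γ.analyticAt_act
    have e2 : AnalyticAt 𝕜 (fun p : (Fin s → 𝕜) × (Fin r → 𝕜) => θ p.2) (Γ.base, 0) :=
      AnalyticAt.fun_comp (f := Prod.snd) hθ analyticAt_snd
    exact AnalyticAt.fun_comp (f := fun p : (Fin s → 𝕜) × (Fin r → 𝕜) => (p.1, θ p.2))
      (x := (Γ.base, 0)) e1 (analyticAt_fst.prod e2)
  refine ⟨⟨Γ.base, fun x a => Γ.act x (θ a), hact, ?_, ?_⟩, fun V hV => ?_, ?_⟩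
  · simpa only [hθ0] using Γ.act_zero
  · have t1 : Tendsto (fun p : (Fin s → 𝕜) × (Fin r → 𝕜) × (Fin r → 𝕜) => p.1)
      (𝓝 (Γ.base, 0, 0)) (𝓝 Γ.base) := continuousAt_fst
    have t' : Tendsto (fun p : (Fin s → 𝕜) × (Fin r → 𝕜) × (Fin r → 𝕜) => p.2)
      (𝓝 (Γ.base, 0, 0)) (𝓝 (0, 0)) := continuousAt_snd
    have t2 := (continuousAt_fst (p := ((0 : Fin r → 𝕜), (0 : Fin r → 𝕜)))).tendsto.comp t'
    have t3 := (continuousAt_snd (p := ((0 : Fin r → 𝕜), (0 : Fin r → 𝕜)))).tendsto.comp t'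
    filter_upwards [(t1.prodMk_nhds ((tθ.comp t2).prodMk_nhds (tθ.comp t3))).eventually Γ.act_act,
      t'.eventually h3] with p e1 e2
    rw [e2]
    exact e1
  · have hV' : θ '' V ∈ 𝓝 0 := by
      filter_upwards [h2, tη hV] with a' e1 e2 using ⟨η a', e2, e1⟩
    have := ht _ hV'
    rwa [Set.image_image] at this
  · filter_upwards [tθ.eventually Γ.effective, h1] with a e1 e2 e3
    rw [← e2, e1 e3, hη0]

end

/-! ### The theorem -/

theorem theorem3 {𝕜 : Type*} [RCLike 𝕜] {n r : ℕ} (Γ : ContTransGroup 𝕜 n r) (s : ℕ) :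
    Γ.HasRepresentation s ↔
      ∃ m : ℕ, m + s = r ∧ ∃ H : LocalLieSubgroup Γ.group m,
        ∀ (k : ℕ) (N : LocalLieSubgroup Γ.group k),
          N.IsNormal → N.IsContainedIn H → k = 0 := by
  constructor
  · rintro ⟨r', Γ', ht, hiso⟩
    obtain ⟨φ, hφ, heff⟩ := hiso.exists_action ht
    obtain ⟨m, hm, H, hH⟩ := φ.exists_stabilizer hφ
    refine ⟨m, hm, H, fun k N hN hNH => N.order_eq_zero ?_⟩
    have hι : Tendsto N.incl (𝓝 0) (𝓝 0) := by
      simpa [N.incl_zero] using N.analyticAt_incl.continuousAt.tendsto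
    filter_upwards [φ.eventually_isTrivialAt_of_isNormal hφ hN hNH hH, hι.eventually heff]
      with x h1 h2 using h2 h1
  · rintro ⟨m, hm, H, hH⟩
    obtain ⟨φ, hφ, hst⟩ := H.exists_coset_action hm
    obtain ⟨k, N, hN1, hN2⟩ := φ.exists_kernel
    have hι : Tendsto N.incl (𝓝 0) (𝓝 0) := by
      simpa [N.incl_zero] using N.analyticAt_incl.continuousAt.tendsto
    -- A trivial transformation fixes in particular the base coset, so the kernel of the coset
    -- action lies in `H`.
    obtain rfl : k = 0 := hH k N (φ.isNormal_of_kernel N hN1 hN2) (fun W hW => by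
      filter_upwards [hN1, hι.eventually (hst W hW)] with x h1 h2 using h2 h1.self_of_nhds)
    refine ⟨r, ⟨Γ.group, φ.base, φ.act, φ.analyticAt_act, φ.act_zero, φ.act_act, ?_⟩, hφ,
      Γ.group.locallyIsomorphic_refl⟩
    filter_upwards [hN2 Set.univ univ_mem] with a h1 h2
    obtain ⟨y, -, rfl⟩ := h1 h2
    rw [Subsingleton.elim y 0, N.incl_zero]
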